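/- Let $K$ be a field of characteristic zero, $n \ge 0$ an integer, and $P_n = K[x_1,\dots,x_n]$. Let $\mathbb{I}_n$ be the algebra of polynomial integro-differential operators, i.e. the $K$-subalgebra of $\mathrm{End}_K(P_n)$ generated by the multiplications by $x_1,\dots,x_n$, the partial derivatives $\partial/\partial x_1,\dots,\partial/\partial x_n$, and the integrations $\int_1,\dots,\int_n$, where $\int_i$ is the $K$-linear map with $\int_i x_1^{m_1}\cdots x_n^{m_n} = \frac{1}{m_i+1}\, x_i\, x_1^{m_1}\cdots x_n^{m_n}$. For a ring $R$, a regular left (resp. right) denominator set is a multiplicative subset containing $1$, consisting of two-sided regular elements, and satisfying the left (resp. right) Ore condition. Every ring $R$ has a largest regular left denominator set $S_{l,0}(R)$ and a largest regular right denominator set $S_{r,0}(R)$. Put $Q_l(R) = S_{l,0}(R)^{-1}R$ (the largest left quotient ring of $R$) and $Q_r(R) = R\,S_{r,0}(R)^{-1}$ (the largest right quotient ring of $R$). The ring $R$ is identified with its image in $Q_l(R)$ and in $Q_r(R)$. Let $Q$ be a ring. A subring $S \subseteq Q$ (not necessarily containing $1$) is a left (resp. right) order in $Q$ if every $q \in Q$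 has the form $q = s^{-1}r$ (resp. $q = rs^{-1}$) with $r,s \in S$ and $s$ a unit of $Q$. Two left (resp. right) orders $R_1, R_2$ in $Q$ are equivalent if there are units $a_1,a_2,b_1,b_2$ of $Q$ with $a_1R_1b_1 \subseteq R_2$ and $a_2R_2b_2 \subseteq R_1$. A left (resp. right) order is called a maximal left (resp. right) order if it is maximal with respect to inclusion within its equivalence class of left (resp. right) orders. Theorem. The algebra $\mathbb{I}_n$ is a maximal left order in $Q_l(\mathbb{I}_n)$ and a maximal right order in $Q_r(\mathbb{I}_n)$. -/

import Mathlib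

noncomputable section

/-! ### The algebra of polynomial integro-differential operators -/

/-- Integration `∫_i` on `K[x_1, …, x_n]`: the `K`-linear map with
`x^m ↦ x_i * x^m / (m_i + 1)` on monomials. -/
def integralOp (K : Type*) [Field K] (n : ℕ) (i : Fin n) :
    Module.End K (MvPolynomial (Fin n) K) :=
  (MvPolynomial.basisMonomials (Fin n) K).constr K fun m =>
    MvPolynomial.monomial (m + Finsupp.single i 1) (((m i : K) + 1)⁻¹)

/-- The subalgebra of `End_K(K[x_1, …, x_n])` generated by the multiplications by the variables
`x_i`, the partial derivatives `∂/∂x_i` and the integrations `∫_i`. -/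
def integroDiffAlgebra (K : Type*) [Field K] (n : ℕ) :
    Subalgebra K (Module.End K (MvPolynomial (Fin n) K)) :=
  Algebra.adjoin K
    (Set.range (fun i : Fin n =>
        LinearMap.mulLeft K (MvPolynomial.X i : MvPolynomial (Fin n) K)) ∪
      Set.range (fun i : Fin n =>
        ((MvPolynomial.pderiv i : Derivation K (MvPolynomial (Fin n) K) _) :
          Module.End K (MvPolynomial (Fin n) K))) ∪
      Set.range (integralOp K n))

/-! ### Regular denominator sets and the largest one-sided quotient rings -/

section Denominators

variable (R : Type*) [Ring R]

/-- A regular left denominator set: a multiplicative set (containing `1`) of regular elements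
satisfying the left Ore condition `S r ∩ R s ≠ ∅`.  (Left reversibility, `r s = 0 → s' r = 0`
for some `s'`, holds trivially when `S` consists of regular elements.) -/
def IsRegularLeftDenominatorSet (S : Submonoid R) : Prop :=
  (∀ s ∈ S, IsRegular s) ∧ ∀ r : R, ∀ s ∈ S, ∃ r' : R, ∃ s' ∈ S, s' * r = r' * s

/-- A regular right denominator set: a multiplicative set (containing `1`) of regular elements
satisfying the right Ore condition `r S ∩ s R ≠ ∅`. -/
def IsRegularRightDenominatorSet (S : Submonoid R) : Prop :=
  (∀ s ∈ S, IsRegular s) ∧ ∀ r : R, ∀ s ∈ S, ∃ r' : R, ∃ s' ∈ S, r * s' = s * r'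

/-- `S_{l,0}(R)`: the supremum of all regular left denominator sets of `R`; it is the largest
one by `largestLeftDenominatorSet_isGreatest`. -/
def largestLeftDenominatorSet : Submonoid R :=
  sSup {S | IsRegularLeftDenominatorSet R S}

/-- `S_{r,0}(R)`: the supremum of all regular right denominator sets of `R`; it is the largest
one by `largestRightDenominatorSet_isGreatest`. -/
def largestRightDenominatorSet : Submonoid R :=
  sSup {S | IsRegularRightDenominatorSet R S}

theorem sSup_submonoid_eq_closure {M : Type*} [Monoid M] (T : Set (Submonoid M)) :
    sSup T = Submonoid.closure (⋃ S ∈ T, (S : Set M)) := by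
  simp [Submonoid.closure_iUnion, sSup_eq_iSup]

theorem largestLeftDenominatorSet_isGreatest :
    IsGreatest {S | IsRegularLeftDenominatorSet R S} (largestLeftDenominatorSet R) := by
  refine ⟨⟨fun s hs => ?_, fun r s hs => ?_⟩, fun S hS => le_sSup hS⟩
  · rw [largestLeftDenominatorSet, sSup_submonoid_eq_closure] at hs
    induction hs using Submonoid.closure_induction with
    | mem x hx =>
      obtain ⟨S, hS, hx⟩ := Set.mem_iUnion₂.1 hx
      exact hS.1 x hx
    | one => exact isRegular_one
    | mul x y _ _ hx hy => exact hx.mul hy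
  · have hs' := hs
    rw [largestLeftDenominatorSet, sSup_submonoid_eq_closure] at hs'
    induction hs' using Submonoid.closure_induction generalizing r with
    | mem x hx =>
      obtain ⟨S, hS, hx⟩ := Set.mem_iUnion₂.1 hx
      obtain ⟨r', s', hs', h⟩ := hS.2 r x hx
      exact ⟨r', s', le_sSup (a := S) hS hs', h⟩
    | one => exact ⟨r, 1, one_mem _, by simp⟩
    | mul x y hxm hym hx hy =>
      rw [← sSup_submonoid_eq_closure] at hxm hym
      obtain ⟨r₁, s₁, hs₁, h₁⟩ := hy r hym
      obtain ⟨r₂, s₂, hs₂, h₂⟩ := hx r₁ hxm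
      exact ⟨r₂, s₂ * s₁, mul_mem hs₂ hs₁, by rw [mul_assoc, h₁, ← mul_assoc, h₂, mul_assoc]⟩

theorem largestRightDenominatorSet_isGreatest :
    IsGreatest {S | IsRegularRightDenominatorSet R S} (largestRightDenominatorSet R) := by
  refine ⟨⟨fun s hs => ?_, fun r s hs => ?_⟩, fun S hS => le_sSup hS⟩
  · rw [largestRightDenominatorSet, sSup_submonoid_eq_closure] at hs
    induction hs using Submonoid.closure_induction with
    | mem x hx =>
      obtain ⟨S, hS, hx⟩ := Set.mem_iUnion₂.1 hx
      exact hS.1 x hx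
    | one => exact isRegular_one
    | mul x y _ _ hx hy => exact hx.mul hy
  · have hs' := hs
    rw [largestRightDenominatorSet, sSup_submonoid_eq_closure] at hs'
    induction hs' using Submonoid.closure_induction generalizing r with
    | mem x hx =>
      obtain ⟨S, hS, hx⟩ := Set.mem_iUnion₂.1 hx
      obtain ⟨r', s', hs', h⟩ := hS.2 r x hx
      exact ⟨r', s', le_sSup (a := S) hS hs', h⟩
    | one => exact ⟨r, 1, one_mem _, by simp⟩
    | mul x y hxm hym hx hy =>
      rw [← sSup_submonoid_eq_closure] at hxm hym
      obtain ⟨r₁, s₁, hs₁, h₁⟩ := hx r hxm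
      obtain ⟨r₂, s₂, hs₂, h₂⟩ := hy r₁ hym
      exact ⟨r₂, s₁ * s₂, mul_mem hs₁ hs₂, by rw [← mul_assoc, h₁, mul_assoc, h₂, mul_assoc]⟩

instance largestLeftDenominatorSetOreSet :
    OreLocalization.OreSet (largestLeftDenominatorSet R) :=
  Classical.choice <| OreLocalization.nonempty_oreSet_iff.2
    ⟨fun _ _ s h => ⟨1, by
        rw [((largestLeftDenominatorSet_isGreatest R).1.1 s s.2).right h]⟩,
      fun r s => by
        obtain ⟨r', s', hs', h⟩ := (largestLeftDenominatorSet_isGreatest R).1.2 r s s.2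
        exact ⟨r', ⟨s', hs'⟩, h⟩⟩

/-- Right Ore localization is left Ore localization of the opposite ring. -/
instance largestRightDenominatorSetOreSet :
    OreLocalization.OreSet (largestRightDenominatorSet R).op :=
  Classical.choice <| OreLocalization.nonempty_oreSet_iff.2
    ⟨fun _ _ s h => ⟨1, by
        have := ((largestRightDenominatorSet_isGreatest R).1.1 _ s.2).left
          (congrArg MulOpposite.unop h)
        rw [MulOpposite.unop_injective this]⟩,
      fun r s => by
        obtain ⟨r', s', hs', h⟩ :=
          (largestRightDenominatorSet_isGreatest R).1.2 r.unop _ s.2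
        exact ⟨MulOpposite.op r', ⟨MulOpposite.op s', hs'⟩, MulOpposite.unop_injective h⟩⟩

/-- The largest left quotient ring `Q_l(R) = S_{l,0}(R)⁻¹ R`. -/
def LargestLeftQuotientRing : Type _ :=
  OreLocalization (largestLeftDenominatorSet R) R

instance : Ring (LargestLeftQuotientRing R) :=
  inferInstanceAs (Ring (OreLocalization (largestLeftDenominatorSet R) R))

/-- The largest right quotient ring `Q_r(R) = R S_{r,0}(R)⁻¹`, built as the opposite of the left
localization of `Rᵐᵒᵖ` at the opposite of `S_{r,0}(R)`. -/
def LargestRightQuotientRing : Type _ :=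
  (OreLocalization (largestRightDenominatorSet R).op Rᵐᵒᵖ)ᵐᵒᵖ

instance : Ring (LargestRightQuotientRing R) :=
  inferInstanceAs (Ring (OreLocalization (largestRightDenominatorSet R).op Rᵐᵒᵖ)ᵐᵒᵖ)

/-- The canonical homomorphism `R → Q_l(R)`. -/
def toLargestLeftQuotientRing : R →+* LargestLeftQuotientRing R :=
  (OreLocalization.numeratorRingHom :
    R →+* OreLocalization (largestLeftDenominatorSet R) R)

/-- The canonical homomorphism `R → Q_r(R)`. -/
def toLargestRightQuotientRing : R →+* LargestRightQuotientRing R :=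
  ((OreLocalization.numeratorRingHom :
    Rᵐᵒᵖ →+* OreLocalization (largestRightDenominatorSet R).op Rᵐᵒᵖ).op.comp
      (RingEquiv.opOp R).toRingHom :
    R →+* (OreLocalization (largestRightDenominatorSet R).op Rᵐᵒᵖ)ᵐᵒᵖ)

theorem toLargestLeftQuotientRing_injective :
    Function.Injective (toLargestLeftQuotientRing R) :=
  OreLocalization.numeratorHom_inj fun s hs y h =>
    ((largestLeftDenominatorSet_isGreatest R).1.1 s hs).left (by simpa using h)

theorem toLargestRightQuotientRing_injective :
    Function.Injective (toLargestRightQuotientRing R) := by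
  intro a b h
  have key : Function.Injective (OreLocalization.numeratorHom :
      Rᵐᵒᵖ →* OreLocalization (largestRightDenominatorSet R).op Rᵐᵒᵖ) :=
    OreLocalization.numeratorHom_inj fun s hs y hy =>
      MulOpposite.unop_injective
        (((largestRightDenominatorSet_isGreatest R).1.1 _ hs).right
          (by simpa using congrArg MulOpposite.unop hy))
  exact MulOpposite.op_injective (key (MulOpposite.op_injective h))

/-- `R` as a subring of `Q_l(R)` (via the injective canonical homomorphism). -/
def imageInLargestLeftQuotientRing : NonUnitalSubring (LargestLeftQuotientRing R) :=
  (toLargestLeftQuotientRing R).range.toNonUnitalSubring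

/-- `R` as a subring of `Q_r(R)` (via the injective canonical homomorphism). -/
def imageInLargestRightQuotientRing : NonUnitalSubring (LargestRightQuotientRing R) :=
  (toLargestRightQuotientRing R).range.toNonUnitalSubring

end Denominators

/-! ### Orders (subrings are not required to contain `1`) -/

section Orders

variable {Q : Type*} [Ring Q]

/-- `S` is a left order in `Q`: every element of `Q` is `s⁻¹ r` with `r, s ∈ S`. -/
def IsLeftOrder (S : NonUnitalSubring Q) : Prop :=
  ∀ q : Q, ∃ r ∈ S, ∃ s : Qˣ, (s : Q) ∈ S ∧ q = (↑s⁻¹ : Q) * r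

/-- `S` is a right order in `Q`: every element of `Q` is `r s⁻¹` with `r, s ∈ S`. -/
def IsRightOrder (S : NonUnitalSubring Q) : Prop :=
  ∀ q : Q, ∃ r ∈ S, ∃ s : Qˣ, (s : Q) ∈ S ∧ q = r * (↑s⁻¹ : Q)

/-- Equivalence of orders: `a₁ R₁ b₁ ⊆ R₂` and `a₂ R₂ b₂ ⊆ R₁` for some units
`a₁, a₂, b₁, b₂` of `Q`. -/
def OrderEquivalent (R₁ R₂ : NonUnitalSubring Q) : Prop :=
  ∃ a₁ a₂ b₁ b₂ : Qˣ,
    (∀ x ∈ R₁, (a₁ : Q) * x * b₁ ∈ R₂) ∧ (∀ x ∈ R₂, (a₂ : Q) * x * b₂ ∈ R₁)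

/-- A left order which is maximal under inclusion within its equivalence class of left orders. -/
def IsMaximalLeftOrder (R : NonUnitalSubring Q) : Prop :=
  IsLeftOrder R ∧ Maximal (fun S => IsLeftOrder S ∧ OrderEquivalent R S) R

/-- A right order which is maximal under inclusion within its equivalence class of right
orders. -/
def IsMaximalRightOrder (R : NonUnitalSubring Q) : Prop :=
  IsRightOrder R ∧ Maximal (fun S => IsRightOrder S ∧ OrderEquivalent R S) R

end Orders

end

/-! ### Maximality of orders in which regular elements generate the unit ideal -/

section MaximalOrders

variable {R Q : Type*} [Ring R] [Ring Q]

/-! The heart is that a two-sided ideal of $\mathbb{I}_n$ containing a regular element is everything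
(`integroDiffAlgebra.one_mem_of_isRegular`). Maximality then follows formally: if $R \subseteq S$
and $aSb \subseteq R$ with $a, b \in R$ invertible in $Q$, then $\{r : rSb \subseteq R\}$ is an
ideal containing the regular element $a$, so $Sb \subseteq R$; the ideal $\{r : Sr \subseteq R\}$
then contains $b$, so $S \subseteq R$. The order condition turns the units of an equivalence into
such $a, b$.

For the ideal statement, in the basis $x^m/m!$ each $\int_i$ is a pure shift and $x_i\partial_i$ is
diagonal with entries $m_i$. Since $\partial_i\int_i = 1$, multiplying any $a$ on the right by
enough integrations gives a finite sum of terms $\int^e p(m)$ with $p$ polynomial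
(`exists_mul_mul_shift_mem`); the result is nonzero when $a$ is regular. Commutators with
$x_i\partial_i$ isolate one nonzero term, $\partial$'s cancel $\int^e$, and finite differences
reduce $p$ to a nonzero constant. -/

theorem isRegular_of_isUnit_map {f : R →+* Q} (hf : Function.Injective f) {a : R}
    (ha : IsUnit (f a)) : IsRegular a :=
  ⟨fun x y h => hf (ha.isRegular.left (by simpa using congrArg f h)),
    fun x y h => hf (ha.isRegular.right (by simpa using congrArg f h))⟩

/-- If two-sided ideals of `R` containing a regular element are trivial, then `R` contains every
overring `S` with `a S b ⊆ R`, for `a, b ∈ R` invertible in `Q`. -/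
theorem le_range_of_mul_mul_mem {f : R →+* Q} (hf : Function.Injective f)
    (hR : ∀ (I : TwoSidedIdeal R) (a : R), a ∈ I → IsRegular a → (1 : R) ∈ I)
    {S : NonUnitalSubring Q} (hS : f.range.toNonUnitalSubring ≤ S) {a b : R}
    (ha : IsUnit (f a)) (hb : IsUnit (f b)) (h : ∀ x ∈ S, f a * x * f b ∈ f.range.toNonUnitalSubring) :
    S ≤ f.range.toNonUnitalSubring := by
  have hfS : ∀ r, f r ∈ S := fun r => hS ⟨r, rfl⟩
  -- Closure under right multiplication by $R$ uses $RS \subseteq S$.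
  let I : TwoSidedIdeal R := TwoSidedIdeal.mk' {r | ∀ x ∈ S, f r * x * f b ∈ f.range}
    (fun x _ => by simp [zero_mem])
    (fun {r t} hr ht x hx => by
      simpa only [map_add, add_mul] using add_mem (hr x hx) (ht x hx))
    (fun {r} hr x hx => by simpa only [map_neg, neg_mul] using neg_mem (hr x hx))
    (fun {r t} ht x hx => by
      simpa only [map_mul, mul_assoc] using mul_mem (f.mem_range_self r) (ht x hx))
    (fun {r t} hr x hx => by
      simpa only [map_mul, mul_assoc] using hr _ (mul_mem (hfS t) hx))
  have hI : ∀ r, r ∈ I ↔ ∀ x ∈ S, f r * x * f b ∈ f.range := fun r =>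
    TwoSidedIdeal.mem_mk' _ _ _ _ _ _ r
  let J : TwoSidedIdeal R := TwoSidedIdeal.mk' {r | ∀ x ∈ S, x * f r ∈ f.range}
    (fun x _ => by simp [zero_mem])
    (fun {r t} hr ht x hx => by
      simpa only [map_add, mul_add] using add_mem (hr x hx) (ht x hx))
    (fun {r} hr x hx => by simpa only [map_neg, mul_neg] using neg_mem (hr x hx))
    (fun {r t} ht x hx => by
      simpa only [map_mul, mul_assoc] using ht _ (mul_mem hx (hfS r)))
    (fun {r t} hr x hx => by
      simpa only [map_mul, mul_assoc] using mul_mem (hr x hx) (f.mem_range_self t))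
  have hJ : ∀ r, r ∈ J ↔ ∀ x ∈ S, x * f r ∈ f.range := fun r =>
    TwoSidedIdeal.mem_mk' _ _ _ _ _ _ r
  have h₁ := (hI 1).1 (hR I a ((hI a).2 h) (isRegular_of_isUnit_map hf ha))
  have h₂ := (hJ 1).1 (hR J b ((hJ b).2 fun x hx => by simpa using h₁ x hx)
    (isRegular_of_isUnit_map hf hb))
  intro x hx
  have := h₂ x hx
  rwa [map_one, mul_one] at this

theorem OrderEquivalent.refl (S : NonUnitalSubring Q) : OrderEquivalent S S :=
  ⟨1, 1, 1, 1, by simp, by simp⟩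

/-- Write the units as $a = s^{-1}r$ and $b = u^{-1}t$. The denominator $s$ multiplies $R$ from the
left, while $u$ is absorbed into $S$: $rxt = s\,(a(xu)b)$. -/
theorem isMaximalLeftOrder_range {f : R →+* Q} (hf : Function.Injective f)
    (hR : ∀ (I : TwoSidedIdeal R) (a : R), a ∈ I → IsRegular a → (1 : R) ∈ I)
    (ho : IsLeftOrder f.range.toNonUnitalSubring) :
    IsMaximalLeftOrder f.range.toNonUnitalSubring := by
  refine ⟨ho, ⟨ho, .refl _⟩, ?_⟩
  rintro S ⟨-, -, a, -, b, -, h⟩ hS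
  obtain ⟨_, ⟨r, rfl⟩, s, ⟨s', hs⟩, hr⟩ := ho a
  obtain ⟨_, ⟨t, rfl⟩, u, ⟨u', hu⟩, ht⟩ := ho b
  have hr' : f r = s * a := by rw [hr, Units.mul_inv_cancel_left]
  have ht' : f t = u * b := by rw [ht, Units.mul_inv_cancel_left]
  refine le_range_of_mul_mul_mem hf hR hS (a := r) (b := t) (hr' ▸ (s * a).isUnit)
    (ht' ▸ (u * b).isUnit) fun x hx => ?_
  have := mul_mem (⟨s', rfl⟩ : f s' ∈ f.range.toNonUnitalSubring) (h _ (mul_mem hx (hS ⟨u', rfl⟩)))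
  rw [hr', ht', ← hs, ← hu]
  simpa only [mul_assoc] using this

theorem isMaximalRightOrder_range {f : R →+* Q} (hf : Function.Injective f)
    (hR : ∀ (I : TwoSidedIdeal R) (a : R), a ∈ I → IsRegular a → (1 : R) ∈ I)
    (ho : IsRightOrder f.range.toNonUnitalSubring) :
    IsMaximalRightOrder f.range.toNonUnitalSubring := by
  refine ⟨ho, ⟨ho, .refl _⟩, ?_⟩
  rintro S ⟨-, -, a, -, b, -, h⟩ hS
  obtain ⟨_, ⟨r, rfl⟩, s, ⟨s', hs⟩, hr⟩ := ho a
  obtain ⟨_, ⟨t, rfl⟩, u, ⟨u', hu⟩, ht⟩ := ho b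
  have hr' : f r = a * s := by rw [hr, Units.inv_mul_cancel_right]
  have ht' : f t = b * u := by rw [ht, Units.inv_mul_cancel_right]
  refine le_range_of_mul_mul_mem hf hR hS (a := r) (b := t) (hr' ▸ (a * s).isUnit)
    (ht' ▸ (b * u).isUnit) fun x hx => ?_
  have := mul_mem (h _ (mul_mem (hS ⟨s', rfl⟩) hx)) (⟨u', rfl⟩ : f u' ∈ f.range.toNonUnitalSubring)
  rw [hr', ht', ← hs, ← hu]
  simpa only [mul_assoc] using this

end MaximalOrders

/-! ### Rings as orders in their largest quotient rings -/

section QuotientRings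

variable (R : Type*) [Ring R]

theorem isLeftOrder_imageInLargestLeftQuotientRing :
    IsLeftOrder (imageInLargestLeftQuotientRing R) := by
  intro q
  induction q using OreLocalization.ind with
  | _ r s =>
    refine ⟨toLargestLeftQuotientRing R r, ⟨r, rfl⟩,
      (OreLocalization.numeratorUnit s :
        (OreLocalization (largestLeftDenominatorSet R) R)ˣ), ⟨s, rfl⟩, ?_⟩
    have h : r /ₒ s = ((1 : R) /ₒ s) * (r /ₒ 1) := by simp
    exact h

theorem isRightOrder_imageInLargestRightQuotientRing :
    IsRightOrder (imageInLargestRightQuotientRing R) := by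
  intro q
  obtain ⟨q, rfl⟩ := MulOpposite.op_surjective q
  induction q using OreLocalization.ind with
  | _ r s =>
    refine ⟨toLargestRightQuotientRing R r.unop, ⟨r.unop, rfl⟩,
      Units.opEquiv.symm (MulOpposite.op (OreLocalization.numeratorUnit s :
        (OreLocalization (largestRightDenominatorSet R).op Rᵐᵒᵖ)ˣ)), ⟨(s : Rᵐᵒᵖ).unop, rfl⟩, ?_⟩
    have h : r /ₒ s = ((1 : Rᵐᵒᵖ) /ₒ s) * (r /ₒ 1) := by simp
    exact congrArg MulOpposite.op h

end QuotientRings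

namespace integroDiffAlgebra

variable {K : Type*} [Field K] {n : ℕ}

/-! ### Polynomial functions on `ℕⁿ` -/

/-- Translation of functions on `ℕⁿ`. -/
noncomputable def translate (e : Fin n →₀ ℕ) : ((Fin n →₀ ℕ) → K) →ₐ[K] ((Fin n →₀ ℕ) → K) :=
  AlgHom.pi fun m => Pi.evalAlgHom K _ (m + e)

@[simp] theorem translate_apply (e : Fin n →₀ ℕ) (p : (Fin n →₀ ℕ) → K) (m : Fin n →₀ ℕ) :
    translate e p m = p (m + e) := rfl

variable (K) in
/-- The polynomial functions on `ℕⁿ`. -/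
def polyFun (n : ℕ) : Subalgebra K ((Fin n →₀ ℕ) → K) :=
  Algebra.adjoin K (Set.range fun (i : Fin n) (m : Fin n →₀ ℕ) => (m i : K))

theorem coord_mem_polyFun (i : Fin n) : (fun m : Fin n →₀ ℕ => (m i : K)) ∈ polyFun K n :=
  Algebra.subset_adjoin ⟨i, rfl⟩

theorem translate_mem_polyFun (e : Fin n →₀ ℕ) {p : (Fin n →₀ ℕ) → K} (hp : p ∈ polyFun K n) :
    translate e p ∈ polyFun K n := by
  have : polyFun K n ≤ (polyFun K n).comap (translate e) := by
    refine Algebra.adjoin_le ?_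
    rintro _ ⟨i, rfl⟩
    have h := add_mem (coord_mem_polyFun (K := K) i) ((polyFun K n).algebraMap_mem (e i : K))
    rw [SetLike.mem_coe, Subalgebra.mem_comap]
    convert h using 1
    ext m
    simp
  exact this hp

/-! ### Finite differences -/

/-- The difference operator `p ↦ p(m + e_i) - p(m)`. -/
noncomputable def diff (i : Fin n) : Module.End K ((Fin n →₀ ℕ) → K) :=
  (translate (Finsupp.single i 1)).toLinearMap - 1

theorem diff_apply (i : Fin n) (p : (Fin n →₀ ℕ) → K) :
    diff i p = translate (Finsupp.single i 1) p - p := rfl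

theorem diff_commute (i j : Fin n) : Commute (diff (K := K) i) (diff j) := by
  have : Commute (translate (K := K) (Finsupp.single i 1)).toLinearMap
      (translate (Finsupp.single j 1)).toLinearMap := by
    refine LinearMap.ext fun p => funext fun m => ?_
    simp [add_assoc, add_comm (Finsupp.single i 1)]
  exact (this.sub_left (Commute.one_left _)).sub_right
    ((Commute.one_right _).sub_left (Commute.one_right _))

/-- Twisted Leibniz rule: the last term is the translate of $p$, written as $\Delta_i p + p$. -/
theorem diff_coord_mul (i j : Fin n) (p : (Fin n →₀ ℕ) → K) :
    diff i ((fun m => (m j : K)) * p) =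
      (fun m => (m j : K)) * diff i p + ((Finsupp.single i 1 : Fin n →₀ ℕ) j : K) • (diff i p + p) := by
  ext m
  simp only [diff_apply, Pi.sub_apply, Pi.add_apply, Pi.mul_apply, Pi.smul_apply, translate_apply,
    Finsupp.add_apply, Nat.cast_add, smul_eq_mul]
  ring

theorem diff_pow_coord_mul (i j : Fin n) (k : ℕ) (p : (Fin n →₀ ℕ) → K)
    (hp : (diff i ^ k) p = 0) : (diff i ^ (k + 1)) ((fun m => (m j : K)) * p) = 0 := by
  induction k generalizing p with
  | zero =>
    obtain rfl : p = 0 := hp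
    simp
  | succ k ih =>
    have h : (diff i ^ k) (diff i p) = 0 := by rwa [pow_succ] at hp
    have h' : (diff i ^ (k + 1)) (diff i p) = 0 := by
      rw [← Module.End.mul_apply, ← pow_succ, pow_succ', Module.End.mul_apply, hp, map_zero]
    rw [pow_succ, Module.End.mul_apply, diff_coord_mul, map_add, ih _ h, map_smul, map_add, hp, h']
    simp

theorem exists_diff_pow_eq_zero (i : Fin n) {p : (Fin n →₀ ℕ) → K} (hp : p ∈ polyFun K n) :
    ∃ k, (diff i ^ k) p = 0 := by
  have mono {k l : ℕ} (hkl : k ≤ l) {q : (Fin n →₀ ℕ) → K} (hq : (diff i ^ k) q = 0) :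
      (diff i ^ l) q = 0 := by
    rw [← Nat.sub_add_cancel hkl, pow_add, Module.End.mul_apply, hq, map_zero]
  -- Nilpotency is strengthened to a statement about multiplication by $p$, which passes to
  -- products; $q = 1$ recovers the claim.
  suffices ∀ q : (Fin n →₀ ℕ) → K, (∃ k, (diff i ^ k) q = 0) → ∃ k, (diff i ^ k) (p * q) = 0 by
    simpa using this 1 ⟨1, by ext; simp [diff_apply]⟩
  induction hp using Algebra.adjoin_induction with
  | mem p hp =>
    obtain ⟨j, rfl⟩ := hp
    exact fun q ⟨k, hk⟩ => ⟨k + 1, diff_pow_coord_mul i j k q hk⟩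
  | algebraMap c =>
    exact fun q ⟨k, hk⟩ => ⟨k, by rw [← Algebra.smul_def, map_smul, hk, smul_zero]⟩
  | add p p' _ _ h h' =>
    intro q hq
    obtain ⟨k, hk⟩ := h q hq
    obtain ⟨l, hl⟩ := h' q hq
    exact ⟨max k l, by
      rw [add_mul, map_add, mono (le_max_left _ _) hk, mono (le_max_right _ _) hl, add_zero]⟩
  | mul p p' _ _ h h' => exact fun q hq => by simpa only [mul_assoc] using h _ (h' q hq)

theorem diff_mem_polyFun (i : Fin n) {p : (Fin n →₀ ℕ) → K} (hp : p ∈ polyFun K n) :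
    diff i p ∈ polyFun K n :=
  sub_mem (translate_mem_polyFun _ hp) hp

theorem eq_const_of_diff_eq_zero {p : (Fin n →₀ ℕ) → K} (hp : ∀ i, diff i p = 0)
    (m : Fin n →₀ ℕ) : p m = p 0 := by
  -- An arbitrary base point makes the claim additive in $m$.
  suffices ∀ k, p (k + m) = p k by simpa using this 0
  induction m using Finsupp.induction_linear with
  | zero => simp
  | add e f he hf => intro k; rw [← add_assoc, hf, he]
  | single i l =>
    induction l with
    | zero => simp
    | succ l ih =>
      intro k
      rw [Finsupp.single_add, ← add_assoc]
      exact (sub_eq_zero.1 (congrFun (hp i) _)).trans (ih k)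

theorem pderiv_mem (i : Fin n) :
    ((MvPolynomial.pderiv i : Derivation K (MvPolynomial (Fin n) K) _) :
      Module.End K (MvPolynomial (Fin n) K)) ∈ integroDiffAlgebra K n :=
  Algebra.subset_adjoin (Or.inl (Or.inr ⟨i, rfl⟩))

/-! ### Operators on divided powers -/

variable (K n) [CharZero K]

/-- The basis of divided powers `x^m / m!`. -/
noncomputable def dividedPower : Module.Basis (Fin n →₀ ℕ) K (MvPolynomial (Fin n) K) :=
  (MvPolynomial.basisMonomials (Fin n) K).isUnitSMul
    (w := fun m => ∏ i, ((m i).factorial : K)⁻¹)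
    fun m => (Finset.prod_ne_zero_iff.2 fun i _ =>
      inv_ne_zero (Nat.cast_ne_zero.2 (m i).factorial_ne_zero)).isUnit

variable {n}

theorem dividedPower_apply (m : Fin n →₀ ℕ) :
    dividedPower K n m = MvPolynomial.monomial m (∏ i, ((m i).factorial : K)⁻¹) := by
  simp [dividedPower, Module.Basis.isUnitSMul_apply, MvPolynomial.smul_monomial]

theorem prod_inv_factorial (m : Fin n →₀ ℕ) (i : Fin n) :
    ∏ j, ((m j).factorial : K)⁻¹ =
      (m i + 1) * ∏ j, (((m + Finsupp.single i 1 : Fin n →₀ ℕ) j).factorial : K)⁻¹ := by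
  rw [← Finset.mul_prod_erase _ _ (Finset.mem_univ i),
    ← Finset.mul_prod_erase (Finset.univ) (fun j => (((m + Finsupp.single i 1 : Fin n →₀ ℕ) j).factorial : K)⁻¹)
      (Finset.mem_univ i), ← mul_assoc]
  congr 1
  · have : (m i + 1 : K) ≠ 0 := by exact_mod_cast (m i).succ_ne_zero
    have h' : ((m i).factorial : K) ≠ 0 := by exact_mod_cast (m i).factorial_ne_zero
    simp [Nat.factorial_succ]
    field_simp
  · refine Finset.prod_congr rfl fun j hj => ?_
    simp [Finsupp.single_eq_of_ne (Finset.ne_of_mem_erase hj)]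

/-- The operator `x^m / m! ↦ x^(m+e) / (m+e)!`. -/
noncomputable def shift (e : Fin n →₀ ℕ) : Module.End K (MvPolynomial (Fin n) K) :=
  (dividedPower K n).constr K fun m => dividedPower K n (m + e)

/-- The operators that are diagonal in the basis of divided powers. -/
noncomputable def diag : ((Fin n →₀ ℕ) → K) →ₐ[K] Module.End K (MvPolynomial (Fin n) K) :=
  AlgHom.ofLinearMap
    { toFun := fun p => (dividedPower K n).constr K fun m => p m • dividedPower K n m
      map_add' := fun p q => (dividedPower K n).ext fun m => by
        simp [Module.Basis.constr_basis, add_smul]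
      map_smul' := fun c p => (dividedPower K n).ext fun m => by
        simp [Module.Basis.constr_basis, mul_smul] }
    ((dividedPower K n).ext fun m => by simp [Module.Basis.constr_basis])
    (fun p q => (dividedPower K n).ext fun m => by
      simp [Module.Basis.constr_basis, mul_smul, smul_comm (p m)])

variable {K}

@[simp] theorem shift_dividedPower (e m : Fin n →₀ ℕ) :
    shift K e (dividedPower K n m) = dividedPower K n (m + e) :=
  Module.Basis.constr_basis _ _ _ _

@[simp] theorem diag_dividedPower (p : (Fin n →₀ ℕ) → K) (m : Fin n →₀ ℕ) :
    diag K p (dividedPower K n m) = p m • dividedPower K n m :=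
  (dividedPower K n).constr_basis K (fun m => p m • dividedPower K n m) m

theorem shift_zero : shift K (0 : Fin n →₀ ℕ) = 1 :=
  (dividedPower K n).ext fun m => by simp

theorem shift_add (e f : Fin n →₀ ℕ) : shift K (e + f) = shift K e * shift K f :=
  (dividedPower K n).ext fun m => by simp [add_assoc, add_comm e f]

theorem shift_ne_zero (e : Fin n →₀ ℕ) : shift K e ≠ 0 := fun h =>
  (dividedPower K n).ne_zero (0 + e) (by rw [← shift_dividedPower, h, LinearMap.zero_apply])

/-- The basic commutation rule: coefficients move to the right of integrations at the cost of a
translation. -/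
theorem diag_mul_shift (p : (Fin n →₀ ℕ) → K) (e : Fin n →₀ ℕ) :
    diag K p * shift K e = shift K e * diag K (translate e p) :=
  (dividedPower K n).ext fun m => by simp

/-- The factor $1/(m_i+1)$ is exactly the change from $1/m!$ to $1/(m+e_i)!$; this is the reason for
using divided powers. -/
theorem integralOp_eq_shift (i : Fin n) :
    integralOp K n i = shift K (Finsupp.single i 1) :=
  (dividedPower K n).ext fun m => by
    have : (m i + 1 : K) ≠ 0 := by exact_mod_cast (m i).succ_ne_zero
    rw [shift_dividedPower, dividedPower_apply, dividedPower_apply, prod_inv_factorial K m i,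
      ← mul_one (_ * ∏ _, _), ← smul_eq_mul (_ * ∏ _, _), ← MvPolynomial.smul_monomial, map_smul,
      ← congrFun (MvPolynomial.coe_basisMonomials (Fin n) K) m, integralOp, Module.Basis.constr_basis,
      MvPolynomial.smul_monomial, smul_eq_mul]
    congr 1
    field_simp

theorem mulLeft_X_eq (i : Fin n) :
    LinearMap.mulLeft K (MvPolynomial.X i : MvPolynomial (Fin n) K) =
      shift K (Finsupp.single i 1) * diag K fun m => (m i : K) + 1 :=
  (dividedPower K n).ext fun m => by
    rw [Module.End.mul_apply, diag_dividedPower, map_smul, shift_dividedPower,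
      dividedPower_apply, dividedPower_apply, LinearMap.mulLeft_apply, MvPolynomial.X,
      MvPolynomial.monomial_mul, MvPolynomial.smul_monomial, one_mul, smul_eq_mul,
      ← prod_inv_factorial, add_comm m]

/-- This one-sided inverse lets integrations be cancelled on the left inside an ideal. -/
theorem pderiv_mul_shift (i : Fin n) :
    ((MvPolynomial.pderiv i : Derivation K (MvPolynomial (Fin n) K) _) :
      Module.End K (MvPolynomial (Fin n) K)) * shift K (Finsupp.single i 1) = 1 :=
  (dividedPower K n).ext fun m => by
    rw [Module.End.mul_apply, shift_dividedPower, dividedPower_apply, Module.End.one_apply,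
      dividedPower_apply, prod_inv_factorial K m i]
    simp [MvPolynomial.pderiv_monomial, mul_comm]

theorem mulLeft_X_mul_pderiv (i : Fin n) :
    LinearMap.mulLeft K (MvPolynomial.X i : MvPolynomial (Fin n) K) *
      ((MvPolynomial.pderiv i : Derivation K (MvPolynomial (Fin n) K) _) :
        Module.End K (MvPolynomial (Fin n) K)) = diag K fun m => (m i : K) :=
  (dividedPower K n).ext fun m => by
    rw [Module.End.mul_apply, diag_dividedPower, dividedPower_apply, LinearMap.mulLeft_apply]
    exact (MvPolynomial.X_mul_pderiv_monomial ..).trans (Nat.cast_smul_eq_nsmul K _ _).symm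

/-! ### Membership in the algebra -/

theorem shift_single_mem (i : Fin n) : shift K (Finsupp.single i 1) ∈ integroDiffAlgebra K n :=
  integralOp_eq_shift (K := K) i ▸ Algebra.subset_adjoin (Or.inr ⟨i, rfl⟩)

theorem shift_mem (e : Fin n →₀ ℕ) : shift K e ∈ integroDiffAlgebra K n := by
  induction e using Finsupp.induction_linear with
  | zero => exact shift_zero (K := K) (n := n) ▸ one_mem _
  | add e f he hf => exact shift_add (K := K) e f ▸ mul_mem he hf
  | single i k =>
    induction k with
    | zero => rw [Finsupp.single_zero, shift_zero]; exact one_mem _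
    | succ k ih => rw [Finsupp.single_add, shift_add]; exact mul_mem ih (shift_single_mem i)

theorem diag_mem {p : (Fin n →₀ ℕ) → K} (hp : p ∈ polyFun K n) :
    diag K p ∈ integroDiffAlgebra K n := by
  have : polyFun K n ≤ (integroDiffAlgebra K n).comap (diag K) := by
    refine Algebra.adjoin_le ?_
    rintro _ ⟨i, rfl⟩
    rw [SetLike.mem_coe, Subalgebra.mem_comap, ← mulLeft_X_mul_pderiv]
    exact mul_mem (Algebra.subset_adjoin (Or.inl (Or.inl ⟨i, rfl⟩))) (pderiv_mem i)
  exact this hp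

/-! ### Normal forms -/

variable (K) in
/-- The operators `∫^e p(m)` of weight `e` with polynomial coefficient `p`. -/
noncomputable def homogeneous (e : Fin n →₀ ℕ) : Submodule K (Module.End K (MvPolynomial (Fin n) K)) :=
  (polyFun K n).toSubmodule.map (LinearMap.mulLeft K (shift K e) ∘ₗ (diag K).toLinearMap)

theorem mem_homogeneous {e : Fin n →₀ ℕ} {b : Module.End K (MvPolynomial (Fin n) K)} :
    b ∈ homogeneous K e ↔ ∃ p ∈ polyFun K n, shift K e * diag K p = b := Iff.rfl

variable (K n) in
/-- The span of all homogeneous operators of nonnegative weight. -/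
noncomputable def normalForms : Submodule K (Module.End K (MvPolynomial (Fin n) K)) :=
  ⨆ e, homogeneous K e

theorem normalForms_induction {P : Module.End K (MvPolynomial (Fin n) K) → Prop}
    (h₀ : P 0) (h₁ : ∀ x y, P x → P y → P (x + y))
    (h : ∀ e, ∀ p ∈ polyFun K n, P (shift K e * diag K p))
    {b : Module.End K (MvPolynomial (Fin n) K)} (hb : b ∈ normalForms K n) : P b := by
  refine Submodule.iSup_induction (motive := P) _ hb ?_ h₀ h₁
  rintro e _ ⟨p, hp, rfl⟩
  exact h e p hp

theorem shift_mul_diag_mem (e : Fin n →₀ ℕ) {p : (Fin n →₀ ℕ) → K} (hp : p ∈ polyFun K n) :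
    shift K e * diag K p ∈ normalForms K n :=
  Submodule.mem_iSup_of_mem e (mem_homogeneous.2 ⟨p, hp, rfl⟩)

theorem one_mem_normalForms : 1 ∈ normalForms K n := by
  simpa [shift_zero] using shift_mul_diag_mem (K := K) (0 : Fin n →₀ ℕ) (one_mem _)

theorem shift_mul_mem (e : Fin n →₀ ℕ) {b : Module.End K (MvPolynomial (Fin n) K)}
    (hb : b ∈ normalForms K n) : shift K e * b ∈ normalForms K n := by
  refine normalForms_induction (P := fun b => shift K e * b ∈ normalForms K n) ?_ ?_ ?_ hb
  · simp [zero_mem]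
  · intro x y hx hy
    rw [mul_add]
    exact add_mem hx hy
  · intro f p hp
    rw [← mul_assoc, ← shift_add]; exact shift_mul_diag_mem _ hp

theorem mul_shift_mem (e : Fin n →₀ ℕ) {b : Module.End K (MvPolynomial (Fin n) K)}
    (hb : b ∈ normalForms K n) : b * shift K e ∈ normalForms K n := by
  refine normalForms_induction (P := fun b => b * shift K e ∈ normalForms K n) ?_ ?_ ?_ hb
  · simp [zero_mem]
  · intro x y hx hy
    rw [add_mul]
    exact add_mem hx hy
  · intro f p hp
    rw [mul_assoc, diag_mul_shift, ← mul_assoc, ← shift_add]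
    exact shift_mul_diag_mem _ (translate_mem_polyFun e hp)

theorem diag_mul_mem {q : (Fin n →₀ ℕ) → K} (hq : q ∈ polyFun K n)
    {b : Module.End K (MvPolynomial (Fin n) K)}
    (hb : b ∈ normalForms K n) : diag K q * b ∈ normalForms K n := by
  refine normalForms_induction (P := fun b => diag K q * b ∈ normalForms K n) ?_ ?_ ?_ hb
  · simp [zero_mem]
  · intro x y hx hy
    rw [mul_add]
    exact add_mem hx hy
  · intro f p hp
    rw [← mul_assoc, diag_mul_shift, mul_assoc, ← map_mul]
    exact shift_mul_diag_mem _ (mul_mem (translate_mem_polyFun f hq) hp)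

/-- The extra $\int_i$ commutes past the coefficient and meets $\partial_i$, so no negative weight
survives. -/
theorem pderiv_mul_mul_shift_mem (i : Fin n) {b : Module.End K (MvPolynomial (Fin n) K)}
    (hb : b ∈ normalForms K n) :
    ((MvPolynomial.pderiv i : Derivation K (MvPolynomial (Fin n) K) _) :
      Module.End K (MvPolynomial (Fin n) K)) * b * shift K (Finsupp.single i 1) ∈
      normalForms K n := by
  refine normalForms_induction (P := fun b => _ * b * shift K (Finsupp.single i 1) ∈ normalForms K n) ?_ ?_ ?_ hb
  · simp [zero_mem]
  · intro x y hx hy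
    rw [mul_add, add_mul]
    exact add_mem hx hy
  · intro f p hp
    rw [mul_assoc, mul_assoc, diag_mul_shift, ← mul_assoc (shift K f), ← shift_add, add_comm,
      shift_add, mul_assoc, ← mul_assoc, pderiv_mul_shift, one_mul]
    exact shift_mul_diag_mem _ (translate_mem_polyFun _ hp)

/-- Only derivatives lower the weight, and right integrations compensate for them. Allowing every
$b$ in normal form, not just $1$, is what makes the induction pass through products. -/
theorem exists_mul_mul_shift_mem {a : Module.End K (MvPolynomial (Fin n) K)}
    (ha : a ∈ integroDiffAlgebra K n) : ∀ b ∈ normalForms K n,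
    ∃ e, a * b * shift K e ∈ normalForms K n := by
  induction ha using Algebra.adjoin_induction with
  | mem a ha =>
    intro b hb
    obtain (⟨i, rfl⟩ | ⟨i, rfl⟩) | ⟨i, rfl⟩ := ha
    · refine ⟨0, mul_shift_mem _ ?_⟩
      dsimp only
      rw [mulLeft_X_eq, mul_assoc]
      exact shift_mul_mem _ (diag_mul_mem (add_mem (coord_mem_polyFun i) (one_mem _)) hb)
    · exact ⟨_, pderiv_mul_mul_shift_mem i hb⟩
    · rw [integralOp_eq_shift]
      exact ⟨0, mul_shift_mem _ (shift_mul_mem _ hb)⟩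
  | algebraMap c =>
    intro b hb
    refine ⟨0, mul_shift_mem _ ?_⟩
    rw [← Algebra.smul_def]
    exact Submodule.smul_mem _ _ hb
  | add a a' _ _ h h' =>
    intro b hb
    obtain ⟨e, he⟩ := h b hb
    obtain ⟨f, hf⟩ := h' b hb
    refine ⟨e + f, ?_⟩
    rw [add_mul, add_mul]
    refine add_mem ?_ ?_
    · rw [shift_add, ← mul_assoc]
      exact mul_shift_mem _ he
    · rw [add_comm, shift_add, ← mul_assoc]
      exact mul_shift_mem _ hf
  | mul a a' _ _ h h' =>
    intro b hb
    obtain ⟨e, he⟩ := h' b hb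
    obtain ⟨f, hf⟩ := h _ he
    refine ⟨e + f, ?_⟩
    simpa only [shift_add, mul_assoc] using hf

/-! ### Two-sided ideals -/

variable {I : Submodule K (Module.End K (MvPolynomial (Fin n) K))}

theorem mem_of_shift_mul_mem (hl : ∀ r ∈ integroDiffAlgebra K n, ∀ x ∈ I, r * x ∈ I)
    (e : Fin n →₀ ℕ) : ∀ x, shift K e * x ∈ I → x ∈ I := by
  have one (i : Fin n) (x) (h : shift K (Finsupp.single i 1) * x ∈ I) : x ∈ I := by
    have := hl _ (pderiv_mem i) _ h
    rwa [← mul_assoc, pderiv_mul_shift, one_mul] at this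
  induction e using Finsupp.induction_linear with
  | zero => simp [shift_zero]
  | add e f he hf => exact fun x h => hf x (he _ (by rwa [← mul_assoc, ← shift_add]))
  | single i k =>
    induction k with
    | zero => simp [shift_zero]
    | succ k ih =>
      intro x h
      rw [add_comm, Finsupp.single_add, shift_add, mul_assoc] at h
      exact ih x (one i _ h)

/-- Weights are eigenvalues of the commutator with $x_i\partial_i$. -/
theorem commutator_homogeneous (i : Fin n) {e : Fin n →₀ ℕ}
    {b : Module.End K (MvPolynomial (Fin n) K)} (hb : b ∈ homogeneous K e) :
    diag K (fun m => (m i : K)) * b - b * diag K (fun m => (m i : K)) = (e i : K) • b := by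
  obtain ⟨p, -, rfl⟩ := mem_homogeneous.1 hb
  refine (dividedPower K n).ext fun m => ?_
  simp [smul_smul, ← sub_smul]
  congr 1
  ring

/-- A nonzero ideal element in normal form yields a nonzero homogeneous one. -/
theorem exists_homogeneous_mem (hl : ∀ r ∈ integroDiffAlgebra K n, ∀ x ∈ I, r * x ∈ I)
    (hr : ∀ r ∈ integroDiffAlgebra K n, ∀ x ∈ I, x * r ∈ I) (k : ℕ) :
    ∀ (s : Finset (Fin n →₀ ℕ)) (f : (Fin n →₀ ℕ) → Module.End K (MvPolynomial (Fin n) K)),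
      s.card = k → (∀ e, f e ∈ homogeneous K e) → ∑ e ∈ s, f e ∈ I → ∑ e ∈ s, f e ≠ 0 →
      ∃ e, ∃ b ∈ homogeneous K e, b ∈ I ∧ b ≠ 0 := by
  induction k with
  | zero =>
    intro s f hs _ _ h
    simp [Finset.card_eq_zero.1 hs] at h
  | succ k ih =>
    intro s f hs hf hI h0
    by_cases h : s.card ≤ 1
    · obtain ⟨e, rfl⟩ := Finset.card_eq_one.1 (by omega : s.card = 1)
      rw [Finset.sum_singleton] at hI h0
      exact ⟨e, f e, hf e, hI, h0⟩
    obtain ⟨a, ha, b, hb, hab⟩ := Finset.one_lt_card.1 (not_le.1 h)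
    obtain ⟨i, hi⟩ := Finsupp.ne_iff.1 hab
    -- The operator $[x_i\partial_i, \cdot] - a_i$ kills the weight-$a$ term and rescales the
    -- others, so the sum gets shorter, though it may vanish.
    have erase (a : Fin n →₀ ℕ) (ha : a ∈ s) :
        (diag K (fun m => (m i : K)) * ∑ e ∈ s, f e - (∑ e ∈ s, f e) * diag K (fun m => (m i : K)))
          - (a i : K) • ∑ e ∈ s, f e = ∑ e ∈ s.erase a, ((e i : K) - a i) • f e := by
      rw [Finset.sum_erase _ (by simp), Finset.mul_sum, Finset.sum_mul, Finset.smul_sum,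
        ← Finset.sum_sub_distrib, ← Finset.sum_sub_distrib]
      exact Finset.sum_congr rfl fun e _ => by
        rw [commutator_homogeneous i (hf e)]
        exact (sub_smul (e i : K) (a i : K) (f e)).symm
    have step (a : Fin n →₀ ℕ) (ha : a ∈ s)
        (h : ∑ e ∈ s.erase a, ((e i : K) - a i) • f e ≠ 0) :
        ∃ e, ∃ b ∈ homogeneous K e, b ∈ I ∧ b ≠ 0 := by
      refine ih (s.erase a) (fun e => ((e i : K) - a i) • f e)
        (by rw [Finset.card_erase_of_mem ha, hs, Nat.add_sub_cancel])
        (fun e => Submodule.smul_mem _ _ (hf e)) ?_ h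
      rw [← erase a ha]
      have hd := diag_mem (coord_mem_polyFun (K := K) i)
      exact sub_mem (sub_mem (hl _ hd _ hI) (hr _ hd _ hI)) (Submodule.smul_mem _ _ hI)
    -- If the sum $x$ vanished under both choices, then $a_i x = [x_i\partial_i, x] = b_i x$,
    -- impossible since $a_i \ne b_i$ in characteristic zero.
    by_contra hcon
    have h1 := (erase a ha).trans (by_contra fun h => hcon (step a ha h))
    have h2 := (erase b hb).trans (by_contra fun h => hcon (step b hb h))
    have h3 : ((a i : K) - b i) • ∑ e ∈ s, f e = 0 := by
      refine (sub_smul (a i : K) (b i : K) (∑ e ∈ s, f e)).trans ?_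
      rw [← sub_eq_zero.1 h1, ← sub_eq_zero.1 h2, sub_self]
    refine (smul_ne_zero ?_ h0) h3
    exact sub_ne_zero.2 (by exact_mod_cast hi)

/-- Moving $p$ past $\int_i$ and cancelling $\int_i$ puts the translate of $p$ in $I$ as well. -/
theorem diag_diff_mem (hl : ∀ r ∈ integroDiffAlgebra K n, ∀ x ∈ I, r * x ∈ I)
    (hr : ∀ r ∈ integroDiffAlgebra K n, ∀ x ∈ I, x * r ∈ I) (i : Fin n)
    {p : (Fin n →₀ ℕ) → K} (hp : diag K p ∈ I) : diag K (diff i p) ∈ I := by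
  rw [diff_apply, map_sub]
  refine sub_mem (mem_of_shift_mul_mem hl (Finsupp.single i 1) _ ?_) hp
  rw [← diag_mul_shift]
  exact hr _ (shift_mem _) _ hp

theorem one_mem_of_diag_mem (hl : ∀ r ∈ integroDiffAlgebra K n, ∀ x ∈ I, r * x ∈ I)
    (hr : ∀ r ∈ integroDiffAlgebra K n, ∀ x ∈ I, x * r ∈ I) {p : (Fin n →₀ ℕ) → K}
    (hp : p ∈ polyFun K n) (hpI : diag K p ∈ I) (hp0 : p ≠ 0) : 1 ∈ I := by
  -- Directions are treated one at a time; differences commute, so those already killed stay killed.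
  have main (T : Finset (Fin n)) :
      ∃ q ∈ polyFun K n, diag K q ∈ I ∧ q ≠ 0 ∧ ∀ i ∈ T, diff i q = 0 := by
    induction T using Finset.induction_on with
    | empty => exact ⟨p, hp, hpI, hp0, by simp⟩
    | insert i T _ ih =>
      obtain ⟨q, hq, hqI, hq0, hqT⟩ := ih
      have hpow (k : ℕ) : (diff i ^ k) q ∈ polyFun K n ∧ diag K ((diff i ^ k) q) ∈ I := by
        induction k with
        | zero => exact ⟨hq, hqI⟩
        | succ k ih =>
          rw [pow_succ', Module.End.mul_apply]
          exact ⟨diff_mem_polyFun i ih.1, diag_diff_mem hl hr i ih.2⟩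
      classical
      have hex := exists_diff_pow_eq_zero i hq
      -- The last nonzero iterated difference: the least vanishing exponent is positive because $q
      -- \ne 0$.
      obtain ⟨k, hk⟩ : ∃ k, Nat.find hex = k + 1 :=
        Nat.exists_eq_succ_of_ne_zero fun h => hq0 (by simpa [h] using Nat.find_spec hex)
      refine ⟨(diff i ^ k) q, (hpow k).1, (hpow k).2,
        Nat.find_min hex (hk ▸ Nat.lt_succ_self k), fun j hj => ?_⟩
      obtain rfl | hj := Finset.mem_insert.1 hj
      · rw [← Module.End.mul_apply, ← pow_succ', ← hk]
        exact Nat.find_spec hex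
      · rw [← Module.End.mul_apply, ((diff_commute j i).pow_right k).eq, Module.End.mul_apply,
          hqT j hj, map_zero]
  obtain ⟨q, -, hqI, hq0, hq⟩ := main Finset.univ
  have hc := eq_const_of_diff_eq_zero fun i => hq i (Finset.mem_univ i)
  have hq0' : q 0 ≠ 0 := fun h => hq0 (funext fun m => (hc m).trans h)
  have h1 : (q 0)⁻¹ • q = 1 := funext fun m => by simp [hc m, hq0']
  rw [← map_one (diag K), ← h1, map_smul]
  exact Submodule.smul_mem _ _ hqI

theorem one_mem_of_normalForms (hl : ∀ r ∈ integroDiffAlgebra K n, ∀ x ∈ I, r * x ∈ I)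
    (hr : ∀ r ∈ integroDiffAlgebra K n, ∀ x ∈ I, x * r ∈ I)
    {b : Module.End K (MvPolynomial (Fin n) K)} (hb : b ∈ normalForms K n) (hbI : b ∈ I)
    (hb0 : b ≠ 0) : 1 ∈ I := by
  obtain ⟨f, hf, rfl⟩ := (Submodule.mem_iSup_iff_exists_finsupp _ _).1 hb
  obtain ⟨e, b, hb, hbI, hb0⟩ := exists_homogeneous_mem hl hr _ f.support f rfl hf hbI hb0
  obtain ⟨p, hp, rfl⟩ := mem_homogeneous.1 hb
  exact one_mem_of_diag_mem hl hr hp (mem_of_shift_mul_mem hl e _ hbI)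
    fun h => hb0 (by rw [h, map_zero, mul_zero])

/-- A two-sided ideal of the algebra of integro-differential operators that contains a regular
element is the whole algebra. -/
theorem one_mem_of_isRegular (I : TwoSidedIdeal (integroDiffAlgebra K n))
    (a : integroDiffAlgebra K n) (ha : a ∈ I) (hreg : IsRegular a) : 1 ∈ I := by
  -- The ideal is viewed inside $\mathrm{End}_K$, where the normal forms live.
  let J : Submodule K (Module.End K (MvPolynomial (Fin n) K)) :=
    { carrier := {x | ∃ y ∈ I, (y : Module.End K (MvPolynomial (Fin n) K)) = x}
      add_mem' := by
        rintro _ _ ⟨x, hx, rfl⟩ ⟨y, hy, rfl⟩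
        exact ⟨x + y, add_mem hx hy, rfl⟩
      zero_mem' := ⟨0, zero_mem I, rfl⟩
      smul_mem' := by
        rintro c _ ⟨x, hx, rfl⟩
        exact ⟨c • x, by rw [Algebra.smul_def]; exact I.mul_mem_left _ _ hx, rfl⟩ }
  obtain ⟨e, he⟩ := exists_mul_mul_shift_mem a.2 1 one_mem_normalForms
  rw [mul_one] at he
  obtain ⟨y, hy, hy1⟩ : 1 ∈ J := by
    refine one_mem_of_normalForms ?_ ?_ he
      ⟨a * ⟨shift K e, shift_mem e⟩, I.mul_mem_right _ _ ha, rfl⟩ fun h => ?_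
    · rintro r hr _ ⟨x, hx, rfl⟩
      exact ⟨⟨r, hr⟩ * x, I.mul_mem_left _ _ hx, rfl⟩
    · rintro r hr _ ⟨x, hx, rfl⟩
      exact ⟨x * ⟨r, hr⟩, I.mul_mem_right _ _ hx, rfl⟩
    -- Regularity of $a$ enters here: $a\int^e = 0$ would force $\int^e = 0$.
    · have : (⟨shift K e, shift_mem e⟩ : integroDiffAlgebra K n) = 0 :=
        hreg.left (by dsimp only; rw [mul_zero]; exact Subtype.ext h)
      exact shift_ne_zero e (congrArg Subtype.val this)
  obtain rfl : y = 1 := Subtype.ext hy1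
  exact hy

end integroDiffAlgebra

theorem mainTheorem4 (K : Type*) [Field K] [CharZero K] (n : ℕ) :
    IsMaximalLeftOrder (imageInLargestLeftQuotientRing (integroDiffAlgebra K n)) ∧
      IsMaximalRightOrder (imageInLargestRightQuotientRing (integroDiffAlgebra K n)) := by
  exact ⟨isMaximalLeftOrder_range (toLargestLeftQuotientRing_injective _)
      integroDiffAlgebra.one_mem_of_isRegular (isLeftOrder_imageInLargestLeftQuotientRing _),
    isMaximalRightOrder_range (toLargestRightQuotientRing_injective _)
      integroDiffAlgebra.one_mem_of_isRegular (isRightOrder_imageInLargestRightQuotientRing _)⟩
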